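/- Let $G=(V,E)$ be a finite connected (simple, undirected, unweighted) graph with $n=|V|$ nodes, let $d_x$ be the degree of the node $x$, let $L=D-A$ be its Laplacian matrix, fix a root $v\in V$, and let $L_v$ be the matrix obtained from $L$ by deleting the row and the column of $v$. Vectors $\mathbf e_u$ ($u\ne v$) and $\vec 1$ are indexed by $V\setminus\{v\}$. The loop-erased walk $\mathrm{LE}_v$ with root $v$ (Wilson's algorithm) is the following random process. Fix an arbitrary ordering of $V\setminus\{v\}$. Every node $u$ has a stack $S[u]$, initially empty, and at first only $v$ is gray. As long as some node is not gray, start a random walk at the first non-gray node of the ordering: when the walk is at the node $u$, a neighbour $w$ of $u$ is selected uniformly at random, independently of all earlier selections, $w$ is pushed on the top of $S[u]$, and the walk moves to $w$. The walk stops when it reaches a gray node; then all nodes on its loop-erased trajectory (loops are erased in the order in which they arise) become gray. Nothing is ever removed from the stacks during the process. It ends when all nodes are gray. Given the resulting stacks, the loop-included path $\mathcal P_{\mathrm{LE}_v}[s]$ from a node $s\in V$ starts at $s$ and, as long as it has not reached $v$, moves from its current node $u$ to the node at the bottom of $S[u]$, which is then removed from (a copy of) $S[u]$. A pass of $u\neq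 v$ is an occurrence of $u$ in the path, the start included. The normalized length $|\mathcal P|_n$ of such a path is the sum of $1/d_x$ over the nodes $x\ne v$ it passes, with repetitions (the final node $v$ is not counted). Then $L_v$ is invertible; almost surely the process ends after finitely many steps, and for every $s\in V$ the path $\mathcal P_{\mathrm{LE}_v}[s]$ reaches $v$ without meeting an empty stack. Moreover, for every $u\in V\setminus\{v\}$: 1. if $s$ is chosen uniformly at random from $V$, independently of $\mathrm{LE}_v$, then the number of passes of $u$ in $\mathcal P_{\mathrm{LE}_v}[s]$, divided by $d_u$, is integrable, and its expectation is $$\tilde\tau^n_{\mathrm{LE}_v}[u]=\frac1n\,\mathbf e_u^TL_v^{-1}\vec 1;$$ 2. the normalized length of $\mathcal P_{\mathrm{LE}_v}[u]$ is integrable, and $$E\big[\,|\mathcal P_{\mathrm{LE}_v}[u]|_n\,\big]=\mathbf e_u^TL_v^{-1}\vec 1.$$ -/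

import Mathlib

open MeasureTheory ProbabilityTheory Matrix

namespace LoopErased

/-- The state of a loop-erased walk process. -/
structure State (V : Type*) where
  /-- The stacks `S[u]`, listed from bottom to top.  Loops are not removed from the stacks. -/
  stack : V → List V
  /-- The gray nodes: the root, and the nodes of the loop-erased trajectories finished so far. -/
  gray : Finset V
  /-- The loop-erased trajectory of the random walk in progress, current node first;
  empty when no walk is in progress. -/
  trail : List V

/-- At the start all stacks are empty and only the root `v` is gray. -/
def init {V : Type*} (v : V) : State V where
  stack := fun _ => []
  gray := {v}
  trail := []

/-- Extend a loop-erased trajectory (current node first) by a move to `w`.  If `w` already lies on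
the trajectory, the loop closed at `w` is erased. -/
def extendTrail {V : Type*} [DecidableEq V] (w : V) (trail : List V) : List V :=
  if w ∈ trail then trail.dropWhile (fun x => decide (x ≠ w)) else w :: trail

/-- One step of the process, where `c u` is the neighbour selected if the current node is `u`.
When no walk is in progress, a new one is started at the first node of `order` that is not gray
(if there is none, the process has ended and nothing changes).  When a walk is in progress with
current node `u`, then `c u` is pushed on the top of `S[u]` and the walk moves to `c u`; if this
node is gray, the walk stops and its loop-erased trajectory becomes gray. -/
def step {V : Type*} [DecidableEq V] (order : List V) (c : V → V) (st : State V) : State V :=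
  match st.trail with
  | [] =>
    match order.find? (fun x => decide (x ∉ st.gray)) with
    | none => st
    | some u => { st with trail := [u] }
  | u :: rest =>
    { stack := Function.update st.stack u (st.stack u ++ [c u])
      gray := if c u ∈ st.gray then st.gray ∪ (u :: rest).toFinset else st.gray
      trail := if c u ∈ st.gray then [] else extendTrail (c u) (u :: rest) }

/-- The state after `t` steps, where `ξ (t, u)` is the neighbour selected in step `t` if the
current node is then `u`. -/
def run {V : Type*} [DecidableEq V] (v : V) (order : List V) (ξ : ℕ × V → V) : ℕ → State V
  | 0 => init v
  | t + 1 => step order (fun u => ξ (t, u)) (run v order ξ t)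

/-- The process has terminated by time `t`: all nodes are gray. -/
def TerminatedAt {V : Type*} [Fintype V] [DecidableEq V]
    (v : V) (order : List V) (ξ : ℕ × V → V) (t : ℕ) : Prop :=
  (run v order ξ t).gray = Finset.univ

open scoped Classical in
/-- The stack representation of the complete loop-erased walk with root `v`: the stacks at the
termination of the process (by convention empty if it does not terminate). -/
noncomputable def stackRep {V : Type*} [Fintype V] [DecidableEq V]
    (v : V) (order : List V) (ξ : ℕ × V → V) : V → List V :=
  if h : ∃ t, TerminatedAt v order ξ t then (run v order ξ (Nat.find h)).stack else fun _ => []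

theorem sum_length_update_lt {V : Type*} [Fintype V] [DecidableEq V]
    (S : V → List V) (u w : V) (rest : List V) (h : S u = w :: rest) :
    ∑ x, (Function.update S u rest x).length < ∑ x, (S x).length := by
  refine Finset.sum_lt_sum (fun x _ => ?_) ⟨u, Finset.mem_univ u, by simp [h]⟩
  by_cases hx : x = u
  · subst hx
    simp [h]
  · simp [hx]

/-- The loop-included path from `u` in the stacks `S`, as the list of its nodes: until the root `v`
is reached, the path moves from its current node `u` to the node at the bottom of `S[u]`, which is
removed from `S[u]`.  The list ends with `v`, unless the path meets an empty stack before
(by convention it then breaks off there). -/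
def loopIncludedPath {V : Type*} [Fintype V] [DecidableEq V]
    (v : V) (S : V → List V) (u : V) : List V :=
  if u = v then [v]
  else
    match _h : S u with
    | [] => [u]
    | w :: rest => u :: loopIncludedPath v (Function.update S u rest) w
termination_by ∑ x, (S x).length
decreasing_by exact sum_length_update_lt S u w rest _h

/-- The law of the random selections: all selections are independent, and a selection at the node
`u` is uniform among the neighbours of `u`. -/
noncomputable def selectionLaw {V : Type*} [MeasurableSpace V] (G : SimpleGraph V) :
    Measure (ℕ × V → V) :=
  Measure.infinitePi (fun i : ℕ × V => uniformOn (G.neighborSet i.2))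

/-- The degree-normalized number of passes of the node `u` in a path. -/
noncomputable def normalizedPasses {V : Type*} [Fintype V] [DecidableEq V] (G : SimpleGraph V)
    [DecidableRel G.Adj] (path : List V) (u : V) : ℝ :=
  (path.count u : ℝ) / (G.degree u : ℝ)

/-- The normalized length of a path to the root `v`: the sum of `1 / d_x` over the nodes `x ≠ v` of
the path, with repetitions (the root, where the path ends, is never left and is not counted). -/
noncomputable def normalizedLength {V : Type*} [Fintype V] [DecidableEq V] (G : SimpleGraph V)
    [DecidableRel G.Adj] (v : V) (path : List V) : ℝ :=
  ((path.filter (fun x => decide (x ≠ v))).map (fun x => 1 / (G.degree x : ℝ))).sum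

/-- `L_v`: the Laplacian matrix with the row and the column of `v` removed. -/
def reducedLaplacian {V : Type*} [Fintype V] [DecidableEq V] (G : SimpleGraph V)
    [DecidableRel G.Adj] (v : V) :
    Matrix {x : V // x ≠ v} {x : V // x ≠ v} ℝ :=
  (G.lapMatrix ℝ).submatrix Subtype.val Subtype.val

end LoopErased

/-! Selections may be made in advance: attach to every node an infinite stack of independent uniform
neighbours and let the process use the next unused one. Each step of either version reads a
selection not read before, or ignores what it reads, so the state at each fixed time has the same
law in both versions (`lintegral_run_eq_lintegral_stack`). In the second version the final stack of
a node is an initial segment of its prescribed stack (`stack_getElem?_eq_some`).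

Following bottoms from `s` is then the walk in the prescribed stacks, provided no final stack runs
out. This is deterministic cycle popping: the loop-erased tree leads every node to the root, and
putting erased loops back at the bottoms only inserts detours (`Hits.addCycle`, `Invariant.step`).
The walk again reads only fresh selections, so the loop-included path has the law of a simple random
walk from `s` stopped at the root.

For that walk, the expected sum of weights `b` along the path solves a Dirichlet problem, with
solution `L_v⁻¹ (d b)` extended by zero (`lintegral_tsum_walk`). The weight `e_u / d_u`, averaged
over the start, gives the first formula through the symmetry of `L_v⁻¹`; the weight `1 / d` gives
the second. Invertibility of `L_v` comes from the minimum principle, almost sure termination from a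
supermartingale bound (`lintegral_potential_add_le`). -/

namespace LoopErased

/-! ### Adaptive exploration of independent coordinates. -/

section Exploration

variable {I σ V : Type*}

/-- Resampling one coordinate leaves an infinite product measure unchanged. -/
theorem lintegral_infinitePi_update [DecidableEq I] [MeasurableSpace V] (ν : I → Measure V)
    [∀ i, IsProbabilityMeasure (ν i)] (i : I) {f : (I → V) → ENNReal} (hf : Measurable f) :
    ∫⁻ ξ, f ξ ∂(Measure.infinitePi ν) =
      ∫⁻ ξ, ∫⁻ w, f (Function.update ξ i w) ∂(ν i) ∂(Measure.infinitePi ν) := by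
  have hm : Measurable (fun p : (I → V) × V => Function.update p.1 i p.2) :=
    measurable_update' (X := fun _ => V)
  -- On a cylinder, the constraint at `i` moves to the independent fresh factor and the others stay.
  have key : ((Measure.infinitePi ν).prod (ν i)).map
      (fun p : (I → V) × V => Function.update p.1 i p.2) = Measure.infinitePi ν := by
    refine Measure.eq_infinitePi ν fun s t ht => ?_
    rw [Measure.map_apply hm (MeasurableSet.pi s.countable_toSet fun j _ => ht j)]
    have hset : (fun p : (I → V) × V => Function.update p.1 i p.2) ⁻¹' (Set.pi s t) =
        (Set.pi (s.erase i : Finset I) t) ×ˢ (if i ∈ s then t i else Set.univ) := by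
      ext p
      simp only [Set.mem_preimage, Set.mem_pi, Finset.mem_coe, Set.mem_prod, Finset.mem_erase]
      constructor
      · intro h
        refine ⟨fun j hj => ?_, ?_⟩
        · simpa [hj.1] using h j hj.2
        · split_ifs with hi
          · simpa using h i hi
          · trivial
      · rintro ⟨h1, h2⟩ j hj
        by_cases hji : j = i
        · subst hji
          simpa [hj] using h2
        · simpa [hji] using h1 j ⟨hji, hj⟩
    rw [hset, Measure.prod_prod, Measure.infinitePi_pi ν fun j _ => ht j]
    split_ifs with hi
    · rw [Finset.prod_erase_mul _ _ hi]
    · rw [Finset.erase_eq_of_notMem hi, measure_univ, mul_one]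
  conv_lhs => rw [← key]
  rw [lintegral_map hf hm]
  exact lintegral_prod _ (hf.comp hm).aemeasurable

/-- One step of an adaptive exploration of the coordinates of `ξ`: in the state `st`, the
coordinate `read st` is looked up, and the state is updated according to the value found there. -/
def explore (read : σ → I) (upd : σ → V → σ) (ξ : I → V) (st : σ) : σ :=
  upd st (ξ (read st))

/-- The coordinates in `used st` determine how the state `st` was reached, and the coordinate looked
up next is not among them. -/
structure IsFresh (read : σ → I) (upd : σ → V → σ) (used : σ → Set I) : Prop where
  notMem : ∀ st, read st ∉ used st
  mono : ∀ st w, used st ⊆ used (upd st w)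
  mem_or : ∀ st w, read st ∈ used (upd st w) ∨ ∀ w', upd st w' = upd st w

variable {read : σ → I} {upd : σ → V → σ} {used : σ → Set I}

/-- At each step the value read is either recorded in `used`, where the two inputs agree, or
irrelevant to the update. -/
theorem IsFresh.iterate_congr (h : IsFresh read upd used) (st₀ : σ) (ξ ξ' : I → V) (t : ℕ)
    (hξ : ∀ i ∈ used ((explore read upd ξ)^[t] st₀), ξ' i = ξ i) :
    (explore read upd ξ')^[t] st₀ = (explore read upd ξ)^[t] st₀ := by
  induction t with
  | zero => rfl
  | succ t ih =>
    rw [Function.iterate_succ_apply'] at hξ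
    rw [Function.iterate_succ_apply', Function.iterate_succ_apply',
      ih fun i hi => hξ i (h.mono _ _ hi)]
    rcases h.mem_or ((explore read upd ξ)^[t] st₀)
      (ξ (read ((explore read upd ξ)^[t] st₀))) with h' | h'
    · simp only [explore] at hξ ⊢
      rw [hξ _ h']
    · exact h' _

variable [Countable σ] [Finite V] [MeasurableSpace V] [MeasurableSingletonClass V]

theorem measurableSet_iterate_explore_eq (read : σ → I) (upd : σ → V → σ) (st₀ : σ) (t : ℕ)
    (st : σ) : MeasurableSet {ξ : I → V | (explore read upd ξ)^[t] st₀ = st} := by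
  induction t generalizing st with
  | zero => exact MeasurableSet.const (st₀ = st)
  | succ t ih =>
    have : {ξ : I → V | (explore read upd ξ)^[t + 1] st₀ = st} =
        ⋃ st', {ξ : I → V | (explore read upd ξ)^[t] st₀ = st'} ∩
          (fun ξ => ξ (read st')) ⁻¹' {w | upd st' w = st} := by
      ext ξ
      simp [Function.iterate_succ_apply', explore]
    rw [this]
    exact MeasurableSet.iUnion fun st' =>
      (ih st').inter (measurable_pi_apply _ (Set.toFinite _).measurableSet)

theorem measurable_comp_iterate_explore {β : Type*} [MeasurableSpace β] (read : σ → I)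
    (upd : σ → V → σ) (st₀ : σ) (t : ℕ) (g : σ → β) :
    Measurable fun ξ : I → V => g ((explore read upd ξ)^[t] st₀) := by
  let _ : MeasurableSpace σ := ⊤
  have h : Measurable fun ξ : I → V => (explore read upd ξ)^[t] st₀ :=
    measurable_to_countable' fun st => measurableSet_iterate_explore_eq read upd st₀ t st
  exact (measurable_from_top (f := g)).comp h

/-- The Markov property of an exploration which only looks up fresh coordinates. -/
theorem IsFresh.lintegral_iterate_succ (h : IsFresh read upd used) (ν : I → Measure V)
    [∀ i, IsProbabilityMeasure (ν i)] (st₀ : σ) (t : ℕ) (g : σ → ENNReal) :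
    ∫⁻ ξ, g ((explore read upd ξ)^[t + 1] st₀) ∂(Measure.infinitePi ν) =
      ∫⁻ ξ, ∫⁻ w, g (upd ((explore read upd ξ)^[t] st₀) w)
        ∂(ν (read ((explore read upd ξ)^[t] st₀))) ∂(Measure.infinitePi ν) := by
  classical
  -- Conditioning on the state at time `t`: on `A st` the next coordinate is the fixed index `read
  -- st`, which can be resampled.
  let A : σ → Set (I → V) := fun st => {ξ | (explore read upd ξ)^[t] st₀ = st}
  have hA : ∀ st, MeasurableSet (A st) :=
    fun st => measurableSet_iterate_explore_eq read upd st₀ t st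
  have hsplit : ∀ F : (I → V) → ENNReal, Measurable F →
      ∫⁻ ξ, F ξ ∂(Measure.infinitePi ν) =
        ∑' st, ∫⁻ ξ, (A st).indicator F ξ ∂(Measure.infinitePi ν) := by
    intro F hF
    rw [← lintegral_tsum fun st => (hF.indicator (hA st)).aemeasurable]
    refine lintegral_congr fun ξ => ?_
    rw [tsum_eq_single ((explore read upd ξ)^[t] st₀)]
    · simp [A]
    · intro st hst
      exact Set.indicator_of_notMem (fun hmem : ξ ∈ A st => hst hmem.symm) _
  rw [hsplit _ (measurable_comp_iterate_explore read upd st₀ (t + 1) g),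
    hsplit _ (measurable_comp_iterate_explore read upd st₀ t
      (fun st => ∫⁻ w, g (upd st w) ∂(ν (read st))))]
  refine tsum_congr fun st => ?_
  rw [lintegral_infinitePi_update ν (read st)
    ((measurable_comp_iterate_explore read upd st₀ (t + 1) g).indicator (hA st))]
  refine lintegral_congr fun ξ => ?_
  -- The event `A st` depends only on the coordinates in `used st`, and freshness keeps `read st`
  -- out of them.
  have hiff : ∀ w, Function.update ξ (read st) w ∈ A st ↔ ξ ∈ A st := by
    intro w
    have hagree : ∀ i ∈ used st, Function.update ξ (read st) w i = ξ i := fun i hi =>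
      Function.update_of_ne (ne_of_mem_of_not_mem hi (h.notMem st)) _ _
    constructor
    · intro hw
      have hw' : (explore read upd (Function.update ξ (read st) w))^[t] st₀ = st := hw
      exact (h.iterate_congr st₀ _ ξ t fun i hi => by
        rw [hw'] at hi; exact (hagree i hi).symm).trans hw'
    · intro hw
      have hw' : (explore read upd ξ)^[t] st₀ = st := hw
      exact (h.iterate_congr st₀ ξ _ t fun i hi => by
        rw [hw'] at hi; exact hagree i hi).trans hw'
  by_cases hξ : ξ ∈ A st
  · have hξ' : (explore read upd ξ)^[t] st₀ = st := hξ
    simp only [Set.indicator_of_mem hξ, Set.indicator_of_mem ((hiff _).2 hξ), hξ']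
    refine lintegral_congr fun w => ?_
    have hw : (explore read upd (Function.update ξ (read st) w))^[t] st₀ = st := (hiff w).2 hξ
    rw [Function.iterate_succ_apply', hw, explore, Function.update_self]
  · simp only [Set.indicator_of_notMem hξ, Set.indicator_of_notMem (fun hw => hξ ((hiff _).1 hw)),
      lintegral_zero]

end Exploration

/-! ### Cycle popping: the final stacks lead every node to the root. -/

section Paths

variable {V : Type*} [DecidableEq V]

/-- `Hits A R s`: the path from `s` in the stacks `R` reaches the set `A` before it meets an empty
stack. -/
inductive Hits (A : Set V) : (V → List V) → V → Prop
  | here {R : V → List V} {s : V} (hs : s ∈ A) : Hits A R s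
  | step {R : V → List V} {s w : V} {rest : List V} (hR : R s = w :: rest)
      (h : Hits A (Function.update R s rest) w) : Hits A R s

/-- Insert `a` at the bottom of the stack of `b`. -/
def pushBottom (b a : V) (R : V → List V) : V → List V :=
  Function.update R b (a :: R b)

/-- Insert the edges of a trajectory (current node first) which is continued by a move to `a`
at the bottoms of the stacks. -/
def addTrail : V → List V → (V → List V) → (V → List V)
  | _, [], R => R
  | a, b :: l, R => addTrail b l (pushBottom b a R)

theorem pushBottom_of_ne {a b s : V} (h : s ≠ b) (R : V → List V) : pushBottom b a R s = R s := by
  simp [pushBottom, h]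

theorem pushBottom_update_comm {a b s : V} (h : s ≠ b) (R : V → List V) (r : List V) :
    pushBottom b a (Function.update R s r) = Function.update (pushBottom b a R) s r := by
  simp only [pushBottom, Function.update_of_ne h.symm]
  rw [Function.update_comm h]

theorem addTrail_of_notMem {s : V} (a : V) (l : List V) (h : s ∉ l) (R : V → List V) :
    addTrail a l R s = R s := by
  induction l generalizing a R with
  | nil => rfl
  | cons b l ih =>
    simp only [List.mem_cons, not_or] at h
    rw [addTrail, ih _ h.2, pushBottom_of_ne h.1]

theorem addTrail_update_comm {s : V} (a : V) (l : List V) (h : s ∉ l) (R : V → List V)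
    (r : List V) :
    addTrail a l (Function.update R s r) = Function.update (addTrail a l R) s r := by
  induction l generalizing a R with
  | nil => rfl
  | cons b l ih =>
    simp only [List.mem_cons, not_or] at h
    rw [addTrail, addTrail, pushBottom_update_comm h.1, ih _ h.2]

theorem addTrail_pushBottom_comm {b : V} (a c : V) (l : List V) (h : b ∉ l) (R : V → List V) :
    addTrail a l (pushBottom b c R) = pushBottom b c (addTrail a l R) := by
  simp only [pushBottom]
  rw [addTrail_update_comm a l h, addTrail_of_notMem a l h]

/-- Only the stacks of the listed nodes are touched; the targets `a` and `b` may lie anywhere. -/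
theorem addTrail_comm (a b : V) (l₁ l₂ : List V) (h : l₁.Disjoint l₂) (R : V → List V) :
    addTrail a l₁ (addTrail b l₂ R) = addTrail b l₂ (addTrail a l₁ R) := by
  induction l₁ generalizing a R with
  | nil => rfl
  | cons c l ih =>
    rw [List.disjoint_cons_left] at h
    rw [addTrail, addTrail, ← addTrail_pushBottom_comm b a l₂ h.1, ih _ h.2]

theorem addTrail_append (a y : V) (l₁ l₂ : List V) (R : V → List V) :
    addTrail a (l₁ ++ y :: l₂) R = addTrail y l₂ (addTrail a (l₁ ++ [y]) R) := by
  induction l₁ generalizing a R with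
  | nil => rfl
  | cons c l ih => simp only [List.cons_append, addTrail, ih]

theorem Hits.pushBottom {A : Set V} {R : V → List V} {a b : V} (h : Hits A R a) :
    Hits A (pushBottom b a R) b := by
  refine Hits.step (w := a) (rest := R b) (by simp [LoopErased.pushBottom]) ?_
  simpa [LoopErased.pushBottom] using h

theorem Hits.addTrail {A : Set V} {R : V → List V} {a : V} (y : V) (l : List V)
    (h : Hits A R a) : Hits A (addTrail a (l ++ [y]) R) y := by
  induction l generalizing a R with
  | nil => exact h.pushBottom
  | cons b l ih => exact ih h.pushBottom

/-- A cycle at the bottoms of the stacks does not affect which nodes are hit. -/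
theorem Hits.addCycle {A : Set V} {R : V → List V} {s : V} (w : V) (l : List V)
    (hl : (l ++ [w]).Nodup) (h : Hits A R s) : Hits A (LoopErased.addTrail w (l ++ [w]) R) s := by
  induction h with
  | here hs => exact Hits.here hs
  | @step R s w' rest hR h ih =>
    by_cases hs : s ∈ l ++ [w]
    · obtain ⟨l₁, l₂, hl₁₂⟩ := List.append_of_mem hs
      -- The cycle is cut at `s`: the path goes from `s` along `l₁` to `w`, from `w` along `l₂` back
      -- to `s`, and then continues in the old stacks `R`.
      rw [hl₁₂, addTrail_append, addTrail_comm]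
      · refine Hits.addTrail s l₁ ?_
        rcases List.eq_nil_or_concat l₂ with rfl | ⟨l₃, y, rfl⟩
        · have : w = s := by
            have := congrArg List.getLast? hl₁₂
            simpa using this
          subst this
          exact Hits.step hR h
        · rw [List.concat_eq_append] at hl₁₂ ⊢
          have : w = y := by
            have := congrArg List.getLast? hl₁₂
            simpa [List.getLast?_append, List.getLast?_cons] using this
          subst this
          exact Hits.addTrail w l₃ (Hits.step hR h)
      · rw [hl₁₂] at hl
        have h1 := List.nodup_append.1 hl
        have h2 := List.nodup_cons.1 h1.2.1
        intro x hx2 hx1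
        rcases List.mem_append.1 hx1 with hx | hx
        · exact h1.2.2 x hx x (List.mem_cons_of_mem _ hx2) rfl
        · rw [List.mem_singleton] at hx
          exact h2.1 (hx ▸ hx2)
    · refine Hits.step (w := w') (rest := rest) (by rw [addTrail_of_notMem _ _ hs, hR]) ?_
      rw [← addTrail_update_comm _ _ hs]
      exact ih

/-- The path stops on entering `A`, so the stack of `u` is never read. -/
theorem Hits.update_of_mem {A : Set V} {R : V → List V} {s u : V} (hu : u ∈ A) (l : List V)
    (h : Hits A R s) : Hits A (Function.update R u l) s := by
  induction h with
  | here hs => exact Hits.here hs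
  | @step R s w rest hR h ih =>
    by_cases hs : s = u
    · exact Hits.here (hs ▸ hu)
    · refine Hits.step (w := w) (rest := rest) (by simp [hs, hR]) ?_
      rwa [Function.update_comm (Ne.symm hs)]

/-- At its first visit to `u` the path finds the stack of `u` intact, and one more move brings it to
`w`. -/
theorem Hits.of_insert {A : Set V} {R : V → List V} {s u w : V} {rest : List V} (hw : w ∈ A)
    (hR : R u = w :: rest) (h : Hits (insert u A) R s) : Hits A R s := by
  induction h with
  | @here R s hs =>
    rcases hs with rfl | hs
    · exact Hits.step hR (Hits.here hw)
    · exact Hits.here hs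
  | @step R s w' rest' hR' h ih =>
    by_cases hs : s = u
    · subst hs
      exact Hits.step hR (Hits.here hw)
    · exact Hits.step hR' (ih (by simpa [Ne.symm hs] using hR))

/-- The trajectory nodes join the target set one at a time, current node first, since each has its
successor at the bottom of its stack. This is the moment when a finished trajectory turns gray. -/
theorem Hits.addTrail_of_mem {A : Set V} {R : V → List V} {w : V} (l : List V) (hl : l.Nodup)
    (hw : w ∈ A) (h : ∀ s, Hits (A ∪ {x | x ∈ l}) R s) (s : V) :
    Hits A (LoopErased.addTrail w l R) s := by
  induction l generalizing A R w s with
  | nil => simpa [LoopErased.addTrail] using h s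
  | cons u l ih =>
    rw [List.nodup_cons] at hl
    refine Hits.of_insert (u := u) (rest := R u) hw ?_ ?_
    · rw [LoopErased.addTrail, addTrail_of_notMem _ _ hl.1]
      simp [LoopErased.pushBottom]
    · refine ih hl.2 (Set.mem_insert u A) (fun s => ?_) s
      have hset : insert u A ∪ {x | x ∈ l} = A ∪ {x | x ∈ u :: l} := by
        ext x
        simp only [Set.mem_union, Set.mem_insert_iff, Set.mem_ofPred_eq, List.mem_cons]
        tauto
      rw [hset]
      exact (h s).update_of_mem (by simp) _

/-- What the states of the process satisfy: popping the cycles closed so far does not affect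
whether the paths in the stacks reach the root, whatever is pushed later. -/
structure Invariant (v : V) (st : State V) : Prop where
  root_mem : v ∈ st.gray
  nodup : st.trail.Nodup
  notMem_gray : ∀ x ∈ st.trail, x ∉ st.gray
  hits : ∀ R : V → List V,
    (∀ s, Hits (st.gray : Set V)
      (match st.trail with
        | [] => R
        | u :: l => addTrail u l R) s) →
    ∀ s, Hits {v} (fun x => st.stack x ++ R x) s

theorem invariant_init (v : V) : Invariant v (init v) where
  root_mem := by simp [init]
  nodup := by simp [init]
  notMem_gray := by simp [init]
  hits R h s := by simpa [init] using h s

theorem extendTrail_of_mem {w : V} {l : List V} (h : w ∈ l) :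
    ∃ l₁ l₂, l = l₁ ++ w :: l₂ ∧ extendTrail w l = w :: l₂ := by
  induction l with
  | nil => simp at h
  | cons a l ih =>
    by_cases ha : a = w
    · subst ha
      exact ⟨[], l, rfl, by simp [extendTrail]⟩
    · have hw : w ∈ l := by simpa [Ne.symm ha] using h
      obtain ⟨l₁, l₂, h1, h2⟩ := ih hw
      refine ⟨a :: l₁, l₂, by simp [h1], ?_⟩
      rw [← h2]
      simp [extendTrail, hw, ha]

theorem exists_extendTrail_eq_cons (w : V) (l : List V) : ∃ l', extendTrail w l = w :: l' := by
  by_cases h : w ∈ l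
  · obtain ⟨_, l₂, -, h⟩ := extendTrail_of_mem h
    exact ⟨l₂, h⟩
  · exact ⟨l, by simp [extendTrail, h]⟩

/-- There are three kinds of move: into a gray node (`Hits.addTrail_of_mem`), onto the trajectory,
closing a cycle (`Hits.addCycle`), and to a new node, where `addTrail` merely unfolds. -/
theorem Invariant.step {v : V} {st : State V} (h : Invariant v st) (order : List V) (c : V → V) :
    Invariant v (step order c st) := by
  obtain ⟨S, A, trail⟩ := st
  obtain ⟨h1, h2, h3, h4⟩ := h
  simp only at h1 h2 h3 h4
  cases trail with
  | nil =>
    cases hf : order.find? (fun x => decide (x ∉ A)) with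
    | none =>
      simp only [LoopErased.step, hf]
      exact ⟨h1, h2, h3, h4⟩
    | some u =>
      have hu : u ∉ A := by simpa using List.find?_some hf
      simp only [LoopErased.step, hf]
      exact ⟨h1, by simp, by simpa using hu, fun R hR => h4 R hR⟩
  | cons u l =>
    have hu : u ∉ l := (List.nodup_cons.1 h2).1
    -- A selection pushed on top of `S[u]` lies at the bottom of what comes later, so it can be
    -- moved into `R`.
    have hstack : ∀ R : V → List V,
        (fun x => Function.update S u (S u ++ [c u]) x ++ R x) =
          fun x => S x ++ pushBottom u (c u) R x := by
      intro R
      funext x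
      by_cases hx : x = u
      · subst hx
        simp [pushBottom]
      · simp [pushBottom, hx]
    by_cases hc : c u ∈ A
    · simp only [LoopErased.step, hc, if_true]
      refine ⟨by simp [h1], by simp, by simp, fun R hR => ?_⟩
      simp only [hstack]
      refine h4 _ fun s => Hits.addTrail_of_mem (u :: l) h2 hc (fun s => ?_) s
      have hset : ((A ∪ (u :: l).toFinset : Finset V) : Set V) = (A : Set V) ∪ {x | x ∈ u :: l} := by
        ext x
        simp [or_left_comm]
      rw [← hset]
      exact hR s
    · simp only [LoopErased.step, hc, if_false]
      by_cases hm : c u ∈ u :: l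
      · obtain ⟨l₁, l₂, hl, he⟩ := extendTrail_of_mem hm
        rw [he]
        rw [hl] at h2 h3
        have h2' := List.nodup_append.1 h2
        refine ⟨h1, h2'.2.1, fun x hx => h3 x (List.mem_append_right _ hx), fun R hR => ?_⟩
        simp only [hstack]
        refine h4 _ fun s => ?_
        change Hits (A : Set V) (addTrail (c u) (u :: l) R) s
        have hn : (l₁ ++ [c u]).Nodup ∧ l₂.Disjoint (l₁ ++ [c u]) := by
          have hsplit : l₁ ++ c u :: l₂ = (l₁ ++ [c u]) ++ l₂ := by simp
          rw [hsplit, List.nodup_append'] at h2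
          exact ⟨h2.1, h2.2.2.symm⟩
        -- The nodes `l₁ ++ [c u]` form the closed cycle and `l₂` is the rest of the surviving
        -- trajectory; disjointness lets the cycle be added last.
        rw [hl, addTrail_append, addTrail_comm _ _ _ _ hn.2]
        exact (hR s).addCycle _ _ hn.1
      · have he : extendTrail (c u) (u :: l) = c u :: u :: l := by simp only [extendTrail, hm, if_false]
        rw [he]
        refine ⟨h1, List.nodup_cons.2 ⟨hm, h2⟩, ?_, fun R hR => ?_⟩
        · intro x hx
          rcases List.mem_cons.1 hx with rfl | hx
          · exact hc
          · exact h3 x hx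
        · simp only [hstack]
          exact h4 _ hR

theorem Invariant.hits_of_gray_eq_univ [Fintype V] {v : V} {st : State V} (h : Invariant v st)
    (hg : st.gray = Finset.univ) (s : V) : Hits {v} st.stack s := by
  simpa using h.hits (fun _ => []) (fun s => Hits.here (by simp [hg])) s

theorem Invariant.trail_eq_nil [Fintype V] {v : V} {st : State V} (h : Invariant v st)
    (hg : st.gray = Finset.univ) : st.trail = [] :=
  List.eq_nil_iff_forall_not_mem.2 fun x hx => h.notMem_gray x hx (by simp [hg])

theorem Hits.getLast?_loopIncludedPath [Fintype V] {v s : V} {S : V → List V}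
    (h : Hits {v} S s) : (loopIncludedPath v S s).getLast? = some v := by
  induction h with
  | @here R s hs =>
    rw [Set.mem_singleton_iff] at hs
    rw [loopIncludedPath, if_pos hs]
    rfl
  | @step R s w rest hR h ih =>
    by_cases hs : s = v
    · rw [loopIncludedPath, if_pos hs]
      rfl
    · rw [loopIncludedPath, if_neg hs]
      split
      · simp_all
      · rename_i w' rest' hR'
        rw [hR] at hR'
        obtain ⟨rfl, rfl⟩ := List.cons.inj hR'
        rw [List.getLast?_cons, ih]
        rfl

end Paths

/-! ### The Dirichlet problem for the reduced Laplacian. -/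

section Harmonic

/-- The minimum principle for superharmonic functions. -/
theorem nonneg_of_superharmonic {V : Type*} [Fintype V] {G : SimpleGraph V}
    [DecidableRel G.Adj] (hG : G.Connected) (v : V) (f : V → ℝ) (hv : 0 ≤ f v)
    (hf : ∀ x, x ≠ v → ∑ y ∈ G.neighborFinset x, f y ≤ G.degree x * f x) (x : V) : 0 ≤ f x := by
  have : Nonempty V := ⟨v⟩
  obtain ⟨m, hm⟩ := Finite.exists_min f
  by_contra hx
  have hneg : f m < 0 := (hm x).trans_lt (not_le.1 hx)
  -- A negative minimum is not attained at `v`; where it is attained, the mean inequality forces it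
  -- on all neighbours, and connectedness carries it to `v`.
  have hprop : ∀ a b, G.Adj a b → f a = f m → f b = f m := by
    intro a b hab ha
    have hav : a ≠ v := by
      rintro rfl
      linarith
    have hsum : ∑ y ∈ G.neighborFinset a, (f y - f m) = 0 := by
      refine le_antisymm ?_ (Finset.sum_nonneg fun y _ => sub_nonneg.2 (hm y))
      rw [Finset.sum_sub_distrib, Finset.sum_const, SimpleGraph.card_neighborFinset_eq_degree,
        nsmul_eq_mul, ← ha]
      linarith [hf a hav]
    have := (Finset.sum_eq_zero_iff_of_nonneg fun y _ => sub_nonneg.2 (hm y)).1 hsum b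
      (by simpa using hab)
    linarith
  have hwalk : ∀ a b, G.Walk a b → f a = f m → f b = f m := by
    intro a b p
    induction p with
    | nil => exact id
    | cons hab _ ih => exact fun ha => ih (hprop _ _ hab ha)
  obtain ⟨p⟩ := hG.preconnected m v
  have := hwalk m v p rfl
  linarith

/-- The extension by zero of a function on the nodes other than the root. -/
def extendZero {V : Type*} [DecidableEq V] (v : V) (f : {x : V // x ≠ v} → ℝ) (x : V) : ℝ :=
  if h : x ≠ v then f ⟨x, h⟩ else 0

@[simp]
theorem extendZero_root {V : Type*} [DecidableEq V] (v : V) (f : {x : V // x ≠ v} → ℝ) :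
    extendZero v f v = 0 := by
  simp [extendZero]

@[simp]
theorem extendZero_coe {V : Type*} [DecidableEq V] (v : V) (f : {x : V // x ≠ v} → ℝ)
    (x : {x : V // x ≠ v}) :
    extendZero v f x = f x := by
  simp [extendZero, x.2]

variable {V : Type*} [Fintype V] [DecidableEq V] {G : SimpleGraph V} [DecidableRel G.Adj]

theorem reducedLaplacian_mulVec (v : V) (f : {x : V // x ≠ v} → ℝ) (x : {x : V // x ≠ v}) :
    (reducedLaplacian G v *ᵥ f) x =
      G.degree x * extendZero v f x - ∑ y ∈ G.neighborFinset x, extendZero v f y := by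
  rw [← SimpleGraph.lapMatrix_mulVec_apply]
  simp only [mulVec, dotProduct, reducedLaplacian, submatrix_apply]
  rw [← Fintype.sum_subtype_add_sum_subtype (fun y => y ≠ v)
    (fun y => G.lapMatrix ℝ x y * extendZero v f y)]
  have h0 : ∑ y : {y : V // ¬ y ≠ v}, G.lapMatrix ℝ x y * extendZero v f y = 0 :=
    Finset.sum_eq_zero fun y _ => by simp [not_not.1 y.2]
  rw [h0, add_zero]
  exact Finset.sum_congr rfl fun y _ => by rw [extendZero_coe]

theorem nonneg_of_reducedLaplacian_mulVec_nonneg (hG : G.Connected) (v : V)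
    (f : {x : V // x ≠ v} → ℝ) (hf : ∀ x, 0 ≤ (reducedLaplacian G v *ᵥ f) x)
    (x : {x : V // x ≠ v}) : 0 ≤ f x := by
  have := nonneg_of_superharmonic hG v (extendZero v f) (by simp) (fun y hy => by
    have := hf ⟨y, hy⟩
    rw [reducedLaplacian_mulVec] at this
    linarith) x
  simpa using this

/-- The minimum principle applied to a kernel vector and to its negative makes it vanish. -/
theorem isUnit_det_reducedLaplacian (hG : G.Connected) (v : V) :
    IsUnit (reducedLaplacian G v).det := by
  rw [isUnit_iff_ne_zero]
  intro hdet
  obtain ⟨f, hf, h0⟩ := exists_mulVec_eq_zero_iff.2 hdet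
  refine hf (funext fun x => le_antisymm ?_ ?_)
  · have := nonneg_of_reducedLaplacian_mulVec_nonneg hG v (-f)
      (fun y => by rw [mulVec_neg, h0]; simp) x
    simpa using this
  · exact nonneg_of_reducedLaplacian_mulVec_nonneg hG v f (fun y => (congrFun h0 y).ge) x

theorem reducedLaplacian_isSymm (v : V) : (reducedLaplacian G v).IsSymm :=
  (SimpleGraph.isSymm_lapMatrix (G := G) ℝ).submatrix _

/-- The solution of the Dirichlet problem with right-hand side `b`. -/
noncomputable def dirichlet (G : SimpleGraph V) [DecidableRel G.Adj] (v : V)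
    (b : {x : V // x ≠ v} → ℝ) : V → ℝ :=
  extendZero v ((reducedLaplacian G v)⁻¹ *ᵥ b)

theorem reducedLaplacian_mulVec_inv (hG : G.Connected) (v : V) (b : {x : V // x ≠ v} → ℝ) :
    reducedLaplacian G v *ᵥ ((reducedLaplacian G v)⁻¹ *ᵥ b) = b := by
  rw [mulVec_mulVec, mul_nonsing_inv _ (isUnit_det_reducedLaplacian hG v), one_mulVec]

theorem dirichlet_nonneg (hG : G.Connected) (v : V) (b : {x : V // x ≠ v} → ℝ)
    (hb : ∀ x, 0 ≤ b x) (x : V) : 0 ≤ dirichlet G v b x := by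
  unfold dirichlet extendZero
  split_ifs with h
  · exact nonneg_of_reducedLaplacian_mulVec_nonneg hG v _
      (fun y => by rw [reducedLaplacian_mulVec_inv hG]; exact hb y) _
  · exact le_rfl

theorem degree_mul_dirichlet (hG : G.Connected) (v : V) (b : {x : V // x ≠ v} → ℝ)
    (x : {x : V // x ≠ v}) :
    G.degree x * dirichlet G v b x = b x + ∑ y ∈ G.neighborFinset x, dirichlet G v b y := by
  have := reducedLaplacian_mulVec (G := G) v ((reducedLaplacian G v)⁻¹ *ᵥ b) x
  rw [reducedLaplacian_mulVec_inv hG] at this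
  unfold dirichlet
  linarith

end Harmonic

/-! ### One step of the random walk. -/

section Uniform

variable {V : Type*} [Fintype V] [MeasurableSpace V] [MeasurableSingletonClass V]
  {G : SimpleGraph V} [DecidableRel G.Adj]

theorem isProbabilityMeasure_uniformOn_neighborSet {x : V} (hx : 0 < G.degree x) :
    IsProbabilityMeasure (uniformOn (G.neighborSet x)) := by
  refine isProbabilityMeasure_uniformOn (Set.toFinite _) ?_
  obtain ⟨y, hy⟩ := (G.degree_pos_iff_exists_adj x).1 hx
  exact ⟨y, hy⟩

theorem isProbabilityMeasure_selectionLaw (hdeg : ∀ x, 0 < G.degree x) :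
    IsProbabilityMeasure (selectionLaw G) := by
  have hP : ∀ i : ℕ × V, IsProbabilityMeasure (uniformOn (G.neighborSet i.2)) :=
    fun i => isProbabilityMeasure_uniformOn_neighborSet (hdeg i.2)
  unfold selectionLaw
  infer_instance

theorem lintegral_uniformOn_neighborSet (x : V) (f : V → ENNReal) :
    ∫⁻ w, f w ∂(uniformOn (G.neighborSet x)) =
      (G.degree x : ENNReal)⁻¹ * ∑ w ∈ G.neighborFinset x, f w := by
  have hs : uniformOn (G.neighborSet x) = uniformOn (G.neighborFinset x : Set V) := by
    rw [SimpleGraph.coe_neighborFinset]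
  rw [hs, uniformOn, ProbabilityTheory.cond, lintegral_smul_measure, Measure.count_apply_finset,
    SimpleGraph.card_neighborFinset_eq_degree, smul_eq_mul, lintegral_finset]
  simp

/-- The Dirichlet equation divided by the degree: the first-step equation of the walk with reward
`b`. This is why `b` enters multiplied by the degree. -/
theorem lintegral_dirichlet [DecidableEq V] (hG : G.Connected) (v : V) (b : {x : V // x ≠ v} → ℝ)
    (hb : ∀ x, 0 ≤ b x) (x : {x : V // x ≠ v}) (hx : 0 < G.degree x) :
    ENNReal.ofReal (dirichlet G v (fun y => G.degree y * b y) x) =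
      ENNReal.ofReal (b x) + ∫⁻ w, ENNReal.ofReal (dirichlet G v (fun y => G.degree y * b y) w)
        ∂(uniformOn (G.neighborSet x)) := by
  have hb' : ∀ y : {x : V // x ≠ v}, 0 ≤ G.degree y * b y :=
    fun y => mul_nonneg (Nat.cast_nonneg _) (hb y)
  have hpos : (0 : ℝ) < G.degree x := Nat.cast_pos.2 hx
  have hnn := dirichlet_nonneg hG v _ hb'
  rw [lintegral_uniformOn_neighborSet, ← ENNReal.ofReal_sum_of_nonneg fun w _ => hnn w,
    ← ENNReal.ofReal_natCast (G.degree x), ← ENNReal.ofReal_inv_of_pos hpos,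
    ← ENNReal.ofReal_mul (inv_nonneg.2 hpos.le),
    ← ENNReal.ofReal_add (hb x) (mul_nonneg (inv_nonneg.2 hpos.le)
      (Finset.sum_nonneg fun w _ => hnn w))]
  congr 1
  have := degree_mul_dirichlet hG v (fun y => G.degree y * b y) x
  field_simp
  linarith

end Uniform

/-! ### Stabilization of the process after termination. -/

section Trajectories

variable {V : Type*} [DecidableEq V] {v : V} {order : List V}

/-- The node at which the next selection is made (the root, if no walk is in progress). -/
def current (v : V) (st : State V) : V :=
  st.trail.headD v

theorem step_eq_step_current (v : V) (order : List V) (c : V → V) (st : State V) :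
    step order c st = step order (fun _ => c (current v st)) st := by
  obtain ⟨S, A, _ | ⟨u, l⟩⟩ := st <;> rfl

theorem find?_eq_none (hmem : ∀ x, x ∈ order ↔ x ≠ v) {A : Finset V} (hv : v ∈ A) :
    order.find? (fun x => decide (x ∉ A)) = none ↔ ∀ x, x ∈ A := by
  rw [List.find?_eq_none]
  simp only [decide_eq_true_eq, not_not, hmem]
  exact ⟨fun h x => if hx : x = v then hx ▸ hv else h x hx, fun h x _ => h x⟩

/-- A sequence of states of the process, for some selections. -/
structure IsTrajectory (v : V) (order : List V) (r : ℕ → State V) : Prop where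
  zero : r 0 = init v
  succ : ∀ t, ∃ c, r (t + 1) = step order c (r t)

theorem isTrajectory_run (v : V) (order : List V) (ξ : ℕ × V → V) :
    IsTrajectory v order (run v order ξ) :=
  ⟨rfl, fun t => ⟨fun u => ξ (t, u), rfl⟩⟩

variable {r : ℕ → State V}

theorem IsTrajectory.invariant (h : IsTrajectory v order r) (t : ℕ) : Invariant v (r t) := by
  induction t with
  | zero => exact h.zero ▸ invariant_init v
  | succ t ih =>
    obtain ⟨c, hc⟩ := h.succ t
    exact hc ▸ ih.step order c

variable [Fintype V]

theorem IsTrajectory.eq_of_terminated (h : IsTrajectory v order r)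
    (hmem : ∀ x, x ∈ order ↔ x ≠ v) {t : ℕ} (ht : (r t).gray = Finset.univ) {t' : ℕ}
    (htt' : t ≤ t') : r t' = r t := by
  induction t', htt' using Nat.le_induction with
  | base => rfl
  | succ n hn ih =>
    obtain ⟨c, hc⟩ := h.succ n
    have hf := (find?_eq_none hmem (h.invariant t).root_mem).2 (by simp [ht])
    have htr := (h.invariant t).trail_eq_nil ht
    rw [hc, ih]
    generalize r t = st at hf htr
    obtain ⟨S, A, l⟩ := st
    simp only at htr hf
    subst htr
    simp only [step, hf]

theorem stackRep_eq (hmem : ∀ x, x ∈ order ↔ x ≠ v) {ξ : ℕ × V → V} {t : ℕ}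
    (ht : TerminatedAt v order ξ t) : stackRep v order ξ = (run v order ξ t).stack := by
  classical
  have hex : ∃ t, TerminatedAt v order ξ t := ⟨t, ht⟩
  have h := isTrajectory_run v order ξ
  rw [stackRep, dif_pos hex]
  rw [h.eq_of_terminated hmem (Nat.find_spec hex) (Nat.find_min' hex ht)]

/-- The `φ`-weight of the loop-included path from `s` if the process has ended, otherwise `0`. -/
noncomputable def pathWeight (v : V) (φ : V → ENNReal) (s : V) (st : State V) : ENNReal :=
  if st.gray = Finset.univ then ((loopIncludedPath v st.stack s).map φ).sum else 0

/-- Monotonicity turns the terminal weight into a supremum over fixed times, where the two versions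
of the process can be compared by monotone convergence. -/
theorem IsTrajectory.monotone_pathWeight (h : IsTrajectory v order r)
    (hmem : ∀ x, x ∈ order ↔ x ≠ v) (φ : V → ENNReal) (s : V) :
    Monotone fun t => pathWeight v φ s (r t) := by
  intro t t' htt'
  by_cases ht : (r t).gray = Finset.univ
  · simp only [h.eq_of_terminated hmem ht htt', le_refl]
  · simp [pathWeight, ht]

theorem IsTrajectory.iSup_pathWeight (h : IsTrajectory v order r)
    (hmem : ∀ x, x ∈ order ↔ x ≠ v) (φ : V → ENNReal) (s : V) {t : ℕ}
    (ht : (r t).gray = Finset.univ) :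
    ⨆ t, pathWeight v φ s (r t) = ((loopIncludedPath v (r t).stack s).map φ).sum := by
  have hval : pathWeight v φ s (r t) = ((loopIncludedPath v (r t).stack s).map φ).sum :=
    if_pos ht
  rw [← hval]
  refine le_antisymm (iSup_le fun t' => ?_) (le_iSup (fun t => pathWeight v φ s (r t)) t)
  have hmono := h.monotone_pathWeight hmem φ s
  refine (hmono (le_max_right t t')).trans ?_
  simp only [h.eq_of_terminated hmem ht (le_max_left t t'), le_refl]

end Trajectories

/-! ### The process and the stopped walk as explorations. -/

section Explorations

variable {V : Type*} [DecidableEq V]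

instance [Finite V] : Countable (State V) := by
  have hinj : Function.Injective
      fun st : State V => (st.stack, st.gray, st.trail) := by
    rintro ⟨S, A, l⟩ ⟨S', A', l'⟩ h
    simp only [Prod.mk.injEq] at h
    obtain ⟨rfl, rfl, rfl⟩ := h
    rfl
  exact hinj.countable

/-- The process reads the selection of the current time at the current node. -/
def clockRead (v : V) (p : ℕ × State V) : ℕ × V := (p.1, current v p.2)

/-- One step of the process together with its clock. -/
def clockUpd (order : List V) (p : ℕ × State V) (w : V) : ℕ × State V :=
  (p.1 + 1, step order (fun _ => w) p.2)

theorem iterate_explore_clock (v : V) (order : List V) (ξ : ℕ × V → V) (t : ℕ) :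
    (explore (clockRead v) (clockUpd order) ξ)^[t] (0, init v) = (t, run v order ξ t) := by
  induction t with
  | zero => rfl
  | succ t ih =>
    rw [Function.iterate_succ_apply', ih]
    simp only [explore, clockUpd, clockRead, run]
    rw [← step_eq_step_current v order (fun u => ξ (t, u))]

theorem isFresh_clock (v : V) (order : List V) :
    IsFresh (clockRead v) (clockUpd order) (fun p => {i | i.1 < p.1}) where
  notMem p := by simp [clockRead]
  mono p w i hi := Nat.lt_succ_of_lt hi
  mem_or p w := Or.inl (Nat.lt_succ_self _)

/-- The process for stacks of selections which are made in advance: the selection with number `k` at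
the node `u` is the value at `(k, u)`. -/
def stackRead (v : V) (st : State V) : ℕ × V :=
  ((st.stack (current v st)).length, current v st)

/-- One step of the process, where `w` is the node selected. -/
def stackUpd (order : List V) (st : State V) (w : V) : State V :=
  step order (fun _ => w) st

theorem isTrajectory_stack (v : V) (order : List V) (η : ℕ × V → V) :
    IsTrajectory v order fun t => (explore (stackRead v) (stackUpd order) η)^[t] (init v) :=
  ⟨rfl, fun _ => ⟨_, Function.iterate_succ_apply' _ _ _⟩⟩

theorem isFresh_stack (v : V) (order : List V) :
    IsFresh (stackRead v) (stackUpd order) (fun st => {i | i.1 < (st.stack i.2).length}) where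
  notMem st := by simp [stackRead]
  mono st w i hi := by
    obtain ⟨S, A, _ | ⟨u, l⟩⟩ := st
    · simp only [stackUpd, step]
      split <;> exact hi
    · simp only [Set.mem_ofPred_eq] at hi
      by_cases hu : i.2 = u
      · simp only [stackUpd, step, Set.mem_ofPred_eq, hu, Function.update_self,
          List.length_append]
        rw [hu] at hi
        omega
      · simpa [stackUpd, step, hu] using hi
  mem_or st w := by
    obtain ⟨S, A, _ | ⟨u, l⟩⟩ := st
    -- With no walk in progress, a selection at the root is read but neither used nor stored.
    · exact Or.inr fun w' => rfl
    · left
      simp [stackUpd, stackRead, step, current]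

theorem stack_getElem?_eq_some (v : V) (order : List V) (η : ℕ × V → V) (t : ℕ) (x : V) (k : ℕ)
    (w : V)
    (h : (((explore (stackRead v) (stackUpd order) η)^[t] (init v)).stack x)[k]? = some w) :
    η (k, x) = w := by
  induction t generalizing x k w with
  | zero => simp [init] at h
  | succ t ih =>
    rw [Function.iterate_succ_apply'] at h
    generalize (explore (stackRead v) (stackUpd order) η)^[t] (init v) = st at h ih
    obtain ⟨S, A, _ | ⟨u, l⟩⟩ := st
    · refine ih x k w ?_
      simp only [explore, stackUpd, step] at h
      split at h <;> exact h
    · simp only [explore, stackUpd, stackRead, step, current, List.headD_cons] at h ih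
      by_cases hx : x = u
      · subst hx
        rw [Function.update_self, List.getElem?_append] at h
        split_ifs at h with hk
        · exact ih _ _ _ h
        · rw [List.getElem?_singleton] at h
          split_ifs at h with hk'
          · have : k = (S x).length := by omega
            rw [this]
            exact Option.some.inj h
      · rw [Function.update_of_ne hx] at h
        exact ih _ _ _ h

/-- The walk in the stacks of `η` until it reaches the root `v`; the state consists of the numbers
of used selections and the current node. -/
def walkRead (p : (V → ℕ) × V) : ℕ × V := (p.1 p.2, p.2)

/-- One step of the walk, where `w` is the node selected. -/
def walkUpd (v : V) (p : (V → ℕ) × V) (w : V) : (V → ℕ) × V :=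
  if p.2 = v then p else (Function.update p.1 p.2 (p.1 p.2 + 1), w)

theorem isFresh_walk (v : V) :
    IsFresh walkRead (walkUpd v) (fun p => {i | i.1 < p.1 i.2}) where
  notMem p := by simp [walkRead]
  mono p w i hi := by
    by_cases hp : p.2 = v
    · simpa [walkUpd, hp] using hi
    · by_cases hu : i.2 = p.2
      · simp only [walkUpd, hp, if_false, Set.mem_ofPred_eq, hu, Function.update_self] at hi ⊢
        omega
      · simpa [walkUpd, hp, hu] using hi
  mem_or p w := by
    by_cases hp : p.2 = v
    · exact Or.inr fun w' => by simp [walkUpd, hp]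
    · exact Or.inl (by simp [walkUpd, walkRead, hp])

theorem iterate_explore_walk_root (v : V) (η : ℕ × V → V) (c : V → ℕ) (t : ℕ) :
    (explore walkRead (walkUpd v) η)^[t] (c, v) = (c, v) :=
  Function.iterate_fixed (by simp [explore, walkUpd]) t

/-- The counters `c` record how many selections the path has consumed, so `S` holds the selections
of `η` from `c` on. After arrival the walk rests at the root, where `φ` vanishes, so the infinite
sum adds nothing. -/
theorem sum_loopIncludedPath_eq_tsum [Fintype V] {v s : V} {S : V → List V} (h : Hits {v} S s)
    (η : ℕ × V → V) (c : V → ℕ)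
    (hS : ∀ x k w, (S x)[k]? = some w → η (c x + k, x) = w) (φ : V → ENNReal) (hφ : φ v = 0) :
    ((loopIncludedPath v S s).map φ).sum =
      ∑' t, φ ((explore walkRead (walkUpd v) η)^[t] (c, s)).2 := by
  have hroot : ∀ (R : V → List V) (c : V → ℕ), ((loopIncludedPath v R v).map φ).sum =
      ∑' t, φ ((explore walkRead (walkUpd v) η)^[t] (c, v)).2 := by
    intro R c
    rw [loopIncludedPath]
    simp [iterate_explore_walk_root, hφ]
  induction h generalizing c with
  | @here R s hs =>
    rw [Set.mem_singleton_iff] at hs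
    subst hs
    exact hroot R c
  | @step R s w rest hR h ih =>
    by_cases hs : s = v
    · subst hs
      exact hroot R c
    · have hpath : loopIncludedPath v R s =
          s :: loopIncludedPath v (Function.update R s rest) w := by
        rw [loopIncludedPath, if_neg hs]
        split
        · simp_all
        · rename_i w' rest' hR'
          rw [hR] at hR'
          obtain ⟨rfl, rfl⟩ := List.cons.inj hR'
          rfl
      have hw : η (c s, s) = w := hS s 0 w (by simp [hR])
      have hnext : explore walkRead (walkUpd v) η (c, s) =
          (Function.update c s (c s + 1), w) := by
        simp [explore, walkRead, walkUpd, hs, hw]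
      rw [hpath, List.map_cons, List.sum_cons, ih (Function.update c s (c s + 1)) ?_,
        tsum_eq_zero_add' (f := fun t => φ ((explore walkRead (walkUpd v) η)^[t] (c, s)).2)
          ENNReal.summable]
      · simp only [Function.iterate_zero, id, Function.iterate_succ_apply, hnext]
      · intro x k w' hk
        by_cases hx : x = s
        · subst hx
          rw [Function.update_self] at hk ⊢
          rw [add_assoc, add_comm 1 k]
          exact hS x (k + 1) w' (by rw [hR]; simpa using hk)
        · rw [Function.update_of_ne hx] at hk ⊢
          exact hS x k w' hk

end Explorations

/-! ### Telescoping and summability. -/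

section Auxiliary

theorem sum_range_add_le_of_le {a q : ℕ → ENNReal} (h : ∀ t, a (t + 1) + q t ≤ a t) (N : ℕ) :
    ∑ t ∈ Finset.range N, q t + a N ≤ a 0 := by
  induction N with
  | zero => simp
  | succ N ih =>
    rw [Finset.sum_range_succ, add_assoc, add_comm (q N)]
    exact (add_le_add_right (h N) _).trans ih

theorem ae_exists_of_tsum_lintegral_lt_top {V Ω : Type*} [Fintype V]
    [DecidableEq V] [MeasurableSpace Ω] {μ : Measure Ω}
    (r : ℕ → Ω → State V)
    (hr : ∀ t, Measurable fun ω => if (r t ω).gray = Finset.univ then (0 : ENNReal) else 1)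
    (h : ∑' t, ∫⁻ ω, (if (r t ω).gray = Finset.univ then 0 else 1) ∂μ < (⊤ : ENNReal)) :
    ∀ᵐ ω ∂μ, ∃ t, (r t ω).gray = Finset.univ := by
  rw [← lintegral_tsum fun t => (hr t).aemeasurable] at h
  filter_upwards [ae_lt_top (Measurable.tsum hr) h.ne] with ω hω
  by_contra hno
  simp only [not_exists] at hno
  simp [hno] at hω

theorem ofReal_list_sum_map {V : Type*} (f : V → ℝ) (hf : ∀ x, 0 ≤ f x) (l : List V) :
    ENNReal.ofReal (l.map f).sum = (l.map fun x => ENNReal.ofReal (f x)).sum := by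
  induction l with
  | nil => simp
  | cons a l ih =>
    rw [List.map_cons, List.sum_cons, ENNReal.ofReal_add (hf a), ih, List.map_cons, List.sum_cons]
    exact List.sum_nonneg (by simpa using fun x _ => hf x)

theorem extendZero_nonneg {V : Type*} [DecidableEq V] {v : V}
    {b : {x : V // x ≠ v} → ℝ} (hb : ∀ x, 0 ≤ b x) (x : V) :
    0 ≤ extendZero v b x := by
  unfold extendZero
  split_ifs
  exacts [hb _, le_rfl]

end Auxiliary

/-! ### Termination and the law of the loop-included path. -/

section Law

variable {V : Type*} [Fintype V] [DecidableEq V] [MeasurableSpace V] [MeasurableSingletonClass V]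
  {G : SimpleGraph V} [DecidableRel G.Adj] {v : V} {order : List V}

theorem lintegral_run_succ (hdeg : ∀ x, 0 < G.degree x) (v : V) (order : List V)
    (g : State V → ENNReal) (t : ℕ) :
    ∫⁻ ξ, g (run v order ξ (t + 1)) ∂(selectionLaw G) =
      ∫⁻ ξ, ∫⁻ w, g (step order (fun _ => w) (run v order ξ t))
        ∂(uniformOn (G.neighborSet (current v (run v order ξ t)))) ∂(selectionLaw G) := by
  have hP : ∀ i : ℕ × V, IsProbabilityMeasure (uniformOn (G.neighborSet i.2)) :=
    fun i => isProbabilityMeasure_uniformOn_neighborSet (hdeg i.2)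
  have := (isFresh_clock v order).lintegral_iterate_succ
    (fun i : ℕ × V => uniformOn (G.neighborSet i.2)) (0, init v) t (fun p => g p.2)
  simp only [iterate_explore_clock] at this
  exact this

theorem lintegral_stack_succ (hdeg : ∀ x, 0 < G.degree x) (v : V) (order : List V)
    (g : State V → ENNReal) (t : ℕ) :
    ∫⁻ η, g ((explore (stackRead v) (stackUpd order) η)^[t + 1] (init v)) ∂(selectionLaw G) =
      ∫⁻ η, ∫⁻ w, g (step order (fun _ => w)
          ((explore (stackRead v) (stackUpd order) η)^[t] (init v)))
        ∂(uniformOn (G.neighborSet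
          (current v ((explore (stackRead v) (stackUpd order) η)^[t] (init v)))))
        ∂(selectionLaw G) := by
  have hP : ∀ i : ℕ × V, IsProbabilityMeasure (uniformOn (G.neighborSet i.2)) :=
    fun i => isProbabilityMeasure_uniformOn_neighborSet (hdeg i.2)
  exact (isFresh_stack v order).lintegral_iterate_succ
    (fun i : ℕ × V => uniformOn (G.neighborSet i.2)) (init v) t g

/-- Making the selections in advance does not change the law of the state at a given time. -/
theorem lintegral_run_eq_lintegral_stack (hdeg : ∀ x, 0 < G.degree x) (v : V) (order : List V)
    (g : State V → ENNReal) (t : ℕ) :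
    ∫⁻ ξ, g (run v order ξ t) ∂(selectionLaw G) =
      ∫⁻ η, g ((explore (stackRead v) (stackUpd order) η)^[t] (init v)) ∂(selectionLaw G) := by
  induction t generalizing g with
  | zero => rfl
  | succ t ih =>
    rw [lintegral_run_succ hdeg, lintegral_stack_succ hdeg]
    -- The mean over the next selection is the same function of the current state in both versions.
    exact ih fun st => ∫⁻ w, g (step order (fun _ => w) st)
      ∂(uniformOn (G.neighborSet (current v st)))

theorem measurable_comp_run {β : Type*} [MeasurableSpace β] (v : V) (order : List V) (t : ℕ)
    (g : State V → β) : Measurable fun ξ : ℕ × V → V => g (run v order ξ t) := by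
  have := measurable_comp_iterate_explore (clockRead v) (clockUpd order) (0, init v) t
    (fun p => g p.2)
  simpa only [iterate_explore_clock] using this

/-- The expected time until a random walk reaches the root. -/
noncomputable def hittingTime (G : SimpleGraph V) [DecidableRel G.Adj] (v x : V) : ENNReal :=
  ENNReal.ofReal (dirichlet G v (fun y => G.degree y * 1) x)

theorem hittingTime_eq (hG : G.Connected) (hdeg : ∀ x, 0 < G.degree x) {x : V} (hx : x ≠ v) :
    hittingTime G v x = 1 + ∫⁻ w, hittingTime G v w ∂(uniformOn (G.neighborSet x)) := by
  have := lintegral_dirichlet hG v (fun _ => 1) (fun _ => zero_le_one) ⟨x, hx⟩ (hdeg x)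
  rwa [ENNReal.ofReal_one] at this

/-- A bound for the expected number of steps from a state to the termination of the process. -/
noncomputable def potential (G : SimpleGraph V) [DecidableRel G.Adj] (v : V) (st : State V) :
    ENNReal :=
  match st.trail with
  | [] => (1 + ∑ x, hittingTime G v x) * (st.grayᶜ.card : ENNReal)
  | x :: _ => (1 + ∑ x, hittingTime G v x) * ((st.grayᶜ.card - 1 : ℕ) : ENNReal) +
      hittingTime G v x

/-- Each non-gray node carries a budget for one start and one hitting time, the latter bounded by
the sum of all. Starting a walk spends one such budget; afterwards the hitting time of the current
node drops by one per step on average. -/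
theorem lintegral_potential_add_le (hG : G.Connected) (hdeg : ∀ x, 0 < G.degree x)
    (hmem : ∀ x, x ∈ order ↔ x ≠ v) {st : State V} (h : Invariant v st) :
    ∫⁻ w, potential G v (step order (fun _ => w) st) ∂(uniformOn (G.neighborSet (current v st))) +
      (if st.gray = Finset.univ then 0 else 1) ≤ potential G v st := by
  have hP : ∀ x, IsProbabilityMeasure (uniformOn (G.neighborSet x)) :=
    fun x => isProbabilityMeasure_uniformOn_neighborSet (hdeg x)
  obtain ⟨S, A, _ | ⟨u, l⟩⟩ := st
  · cases hf : order.find? (fun x => decide (x ∉ A)) with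
    | none =>
      have hA : A = Finset.univ :=
        Finset.eq_univ_iff_forall.2 ((find?_eq_none hmem h.root_mem).1 hf)
      subst hA
      simp only [step, potential, hf]
      simp
    | some u =>
      have hu : u ∉ A := by simpa using List.find?_some hf
      have hA : A ≠ Finset.univ := fun hA => hu (by simp [hA])
      have hcard : 1 ≤ Aᶜ.card := Finset.card_pos.2 ⟨u, by simpa using hu⟩
      obtain ⟨m, hm⟩ := Nat.exists_eq_add_of_le' hcard
      simp only [step, potential, hf, hA, if_false, lintegral_const, measure_univ, mul_one, hm,
        Nat.add_sub_cancel, Nat.cast_add, Nat.cast_one, mul_add, add_assoc]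
      refine add_le_add_right ?_ _
      rw [add_comm]
      refine add_le_add_right ?_ 1
      exact Finset.single_le_sum (f := hittingTime G v) (fun _ _ => zero_le) (Finset.mem_univ u)
  · have hu : u ∉ A := h.notMem_gray u (by simp)
    have huv : u ≠ v := fun huv => hu (huv ▸ h.root_mem)
    have hA : A ≠ Finset.univ := fun hA => hu (by simp [hA])
    have hle : ∀ w, potential G v (step order (fun _ => w) ⟨S, A, u :: l⟩) ≤
        (1 + ∑ x, hittingTime G v x) * ((Aᶜ.card - 1 : ℕ) : ENNReal) + hittingTime G v w := by
      intro w
      by_cases hw : w ∈ A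
      · simp only [step, potential, hw, if_true]
        refine le_add_right ?_
        gcongr
        -- At least `u` turns gray, which pays for the budget already removed at the start of the
        -- walk.
        refine Nat.le_sub_one_of_lt (Finset.card_lt_card ?_)
        refine Finset.ssubset_iff_subset_ne.2 ⟨?_, fun heq => ?_⟩
        · exact Finset.compl_subset_compl.2 Finset.subset_union_left
        · have : u ∈ (A ∪ (u :: l).toFinset)ᶜ := heq ▸ (by simpa using hu)
          simp at this
      · obtain ⟨l', hl'⟩ := exists_extendTrail_eq_cons w (u :: l)
        simp only [step, potential, hw, if_false, hl', le_refl]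
    simp only [hA, if_false]
    refine (add_le_add_left (lintegral_mono hle) 1).trans ?_
    rw [lintegral_add_left, lintegral_const, measure_univ, mul_one]
    · simp only [potential, current, List.headD_cons]
      rw [hittingTime_eq hG hdeg huv, add_assoc, add_comm _ (1 : ENNReal)]
    · exact measurable_const

theorem tsum_lintegral_not_terminated_lt_top (hG : G.Connected) (hdeg : ∀ x, 0 < G.degree x)
    (hmem : ∀ x, x ∈ order ↔ x ≠ v) :
    ∑' t, ∫⁻ ξ, (if (run v order ξ t).gray = Finset.univ then 0 else 1) ∂(selectionLaw G) <
      (⊤ : ENNReal) := by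
  have := isProbabilityMeasure_selectionLaw hdeg
  have hle : ∀ t, ∫⁻ ξ, potential G v (run v order ξ (t + 1)) ∂(selectionLaw G) +
      ∫⁻ ξ, (if (run v order ξ t).gray = Finset.univ then 0 else 1) ∂(selectionLaw G) ≤
      ∫⁻ ξ, potential G v (run v order ξ t) ∂(selectionLaw G) := by
    intro t
    rw [lintegral_run_succ hdeg, ← lintegral_add_right]
    · exact lintegral_mono fun ξ =>
        lintegral_potential_add_le hG hdeg hmem ((isTrajectory_run v order ξ).invariant t)
    · exact measurable_comp_run v order t fun st =>
        if st.gray = Finset.univ then (0 : ENNReal) else 1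
  have hfin : potential G v (init v) < ⊤ := by
    simp only [potential, init]
    refine ENNReal.mul_lt_top (ENNReal.add_lt_top.2 ⟨ENNReal.one_lt_top, ?_⟩)
      (ENNReal.natCast_lt_top _)
    exact ENNReal.sum_lt_top.2 fun x _ => ENNReal.ofReal_lt_top
  refine lt_of_le_of_lt ?_ hfin
  rw [ENNReal.tsum_eq_iSup_nat]
  refine iSup_le fun N => le_self_add.trans ((sum_range_add_le_of_le hle N).trans ?_)
  simp [run]

theorem ae_terminated_run (hG : G.Connected) (hdeg : ∀ x, 0 < G.degree x)
    (hmem : ∀ x, x ∈ order ↔ x ≠ v) :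
    ∀ᵐ ξ ∂(selectionLaw G), ∃ t, TerminatedAt v order ξ t :=
  ae_exists_of_tsum_lintegral_lt_top (fun t ξ => run v order ξ t)
    (fun t => measurable_comp_run v order t fun st =>
      if st.gray = Finset.univ then (0 : ENNReal) else 1)
    (tsum_lintegral_not_terminated_lt_top hG hdeg hmem)

theorem ae_terminated_stack (hG : G.Connected) (hdeg : ∀ x, 0 < G.degree x)
    (hmem : ∀ x, x ∈ order ↔ x ≠ v) :
    ∀ᵐ η ∂(selectionLaw G), ∃ t,
      ((explore (stackRead v) (stackUpd order) η)^[t] (init v)).gray = Finset.univ := by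
  refine ae_exists_of_tsum_lintegral_lt_top
    (fun t η => (explore (stackRead v) (stackUpd order) η)^[t] (init v))
    (fun t => measurable_comp_iterate_explore (stackRead v) (stackUpd order) (init v) t fun st =>
      if st.gray = Finset.univ then (0 : ENNReal) else 1) ?_
  have h := tsum_lintegral_not_terminated_lt_top (order := order) hG hdeg hmem
  have heq := fun t => lintegral_run_eq_lintegral_stack hdeg v order
    (fun st => if st.gray = Finset.univ then (0 : ENNReal) else 1) t
  simpa only [heq] using h

/-- The expectation of an additive functional of the walk until it reaches the root. -/
theorem lintegral_tsum_walk (hG : G.Connected) (hdeg : ∀ x, 0 < G.degree x)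
    (b : {x : V // x ≠ v} → ℝ) (hb : ∀ x, 0 ≤ b x) (s : V) :
    ∫⁻ η, ∑' t, ENNReal.ofReal
        (extendZero v b ((explore walkRead (walkUpd v) η)^[t] (0, s)).2) ∂(selectionLaw G) =
      ENNReal.ofReal (dirichlet G v (fun y => G.degree y * b y) s) := by
  have hP : ∀ i : ℕ × V, IsProbabilityMeasure (uniformOn (G.neighborSet i.2)) :=
    fun i => isProbabilityMeasure_uniformOn_neighborSet (hdeg i.2)
  have := isProbabilityMeasure_selectionLaw hdeg
  have hmeas : ∀ (t : ℕ) (f : V → ENNReal), Measurable fun η : ℕ × V → V =>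
      f ((explore walkRead (walkUpd v) η)^[t] (0, s)).2 := fun t f =>
    measurable_comp_iterate_explore walkRead (walkUpd v) (0, s) t fun p => f p.2
  rw [lintegral_tsum fun t => (hmeas t fun x => ENNReal.ofReal (extendZero v b x)).aemeasurable]
  -- The reward collected before time `N` plus the expected solution at time `N` is constant in `N`.
  have hsum : ∀ (b : {x : V // x ≠ v} → ℝ), (∀ x, 0 ≤ b x) → ∀ N,
      ∑ t ∈ Finset.range N, ∫⁻ η, ENNReal.ofReal
        (extendZero v b ((explore walkRead (walkUpd v) η)^[t] (0, s)).2) ∂(selectionLaw G) +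
      ∫⁻ η, ENNReal.ofReal (dirichlet G v (fun y => G.degree y * b y)
        ((explore walkRead (walkUpd v) η)^[N] (0, s)).2) ∂(selectionLaw G) =
      ENNReal.ofReal (dirichlet G v (fun y => G.degree y * b y) s) := by
    intro b hb N
    induction N with
    | zero => simp
    | succ N ih =>
      rw [← ih, Finset.sum_range_succ, add_assoc]
      congr 1
      have hstep := (isFresh_walk v).lintegral_iterate_succ
        (fun i : ℕ × V => uniformOn (G.neighborSet i.2)) (0, s) N
        (fun p => ENNReal.ofReal (dirichlet G v (fun y => G.degree y * b y) p.2))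
      rw [selectionLaw, hstep, ← lintegral_add_left]
      · refine lintegral_congr fun η => ?_
        generalize (explore walkRead (walkUpd v) η)^[N] (0, s) = p
        by_cases hp : p.2 = v
        · simp [walkUpd, hp, dirichlet]
        · have h1 := lintegral_dirichlet hG v b hb ⟨p.2, hp⟩ (hdeg p.2)
          have h2 := extendZero_coe v b ⟨p.2, hp⟩
          simp only at h1 h2
          simp only [walkUpd, hp, if_false, walkRead]
          rw [h1, h2]
      · exact hmeas N fun x => ENNReal.ofReal (extendZero v b x)
  -- With `b = 1`, `hsum` bounds the sum of the probabilities of not yet being at the root, so these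
  -- tend to zero.
  have htail : Filter.Tendsto (fun N => ∫⁻ η, ENNReal.ofReal
      (extendZero v (fun _ => 1) ((explore walkRead (walkUpd v) η)^[N] (0, s)).2)
      ∂(selectionLaw G)) Filter.atTop (nhds 0) := by
    refine ENNReal.tendsto_atTop_zero_of_tsum_ne_top (ne_top_of_le_ne_top
      (b := ENNReal.ofReal (dirichlet G v (fun y => G.degree y * 1) s)) ENNReal.ofReal_ne_top ?_)
    rw [ENNReal.tsum_eq_iSup_nat]
    exact iSup_le fun N => le_self_add.trans (hsum (fun _ => 1) (fun _ => zero_le_one) N).le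
  let M : ENNReal := ∑ x, ENNReal.ofReal (dirichlet G v (fun y => G.degree y * b y) x)
  have hM : M ≠ ⊤ := (ENNReal.sum_lt_top.2 fun x _ => ENNReal.ofReal_lt_top).ne
  -- The solution is bounded by `M` and vanishes at the root, so the remainder is at most `M` times
  -- the survival probability.
  have hle : ∀ x, ENNReal.ofReal (dirichlet G v (fun y => G.degree y * b y) x) ≤
      M * ENNReal.ofReal (extendZero v (fun _ => 1) x) := by
    intro x
    by_cases hx : x = v
    · simp [hx, dirichlet]
    · have h2 := extendZero_coe v (fun _ => 1) ⟨x, hx⟩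
      simp only at h2
      rw [h2, ENNReal.ofReal_one, mul_one]
      exact Finset.single_le_sum
        (f := fun x => ENNReal.ofReal (dirichlet G v (fun y => G.degree y * b y) x))
        (fun _ _ => zero_le) (Finset.mem_univ x)
  have hrest : Filter.Tendsto (fun N => ∫⁻ η, ENNReal.ofReal
      (dirichlet G v (fun y => G.degree y * b y)
        ((explore walkRead (walkUpd v) η)^[N] (0, s)).2) ∂(selectionLaw G))
      Filter.atTop (nhds 0) := by
    refine tendsto_of_tendsto_of_tendsto_of_le_of_le tendsto_const_nhds
      (h := fun N => M * ∫⁻ η, ENNReal.ofReal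
        (extendZero v (fun _ => 1) ((explore walkRead (walkUpd v) η)^[N] (0, s)).2)
        ∂(selectionLaw G)) ?_ (fun _ => zero_le) fun N => ?_
    · simpa using ENNReal.Tendsto.const_mul htail (Or.inr hM)
    · simp only
      rw [← lintegral_const_mul _ (hmeas N fun x => ENNReal.ofReal (extendZero v (fun _ => 1) x))]
      exact lintegral_mono fun η => hle _
  have hlim := (ENNReal.tendsto_nat_tsum fun t => ∫⁻ η, ENNReal.ofReal
    (extendZero v b ((explore walkRead (walkUpd v) η)^[t] (0, s)).2) ∂(selectionLaw G)).add hrest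
  simp only [hsum b hb, add_zero] at hlim
  exact tendsto_nhds_unique hlim tendsto_const_nhds

/-- The expectation of an additive functional of the loop-included path from `s`. -/
theorem lintegral_loopIncludedPath (hG : G.Connected) (hdeg : ∀ x, 0 < G.degree x)
    (hmem : ∀ x, x ∈ order ↔ x ≠ v) (b : {x : V // x ≠ v} → ℝ) (hb : ∀ x, 0 ≤ b x) (s : V) :
    ∫⁻ ξ, ENNReal.ofReal ((loopIncludedPath v (stackRep v order ξ) s).map (extendZero v b)).sum
        ∂(selectionLaw G) =
      ENNReal.ofReal (dirichlet G v (fun y => G.degree y * b y) s) := by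
  let φ : V → ENNReal := fun x => ENNReal.ofReal (extendZero v b x)
  have h1 : ∫⁻ ξ, ENNReal.ofReal
      ((loopIncludedPath v (stackRep v order ξ) s).map (extendZero v b)).sum ∂(selectionLaw G) =
      ∫⁻ ξ, ⨆ t, pathWeight v φ s (run v order ξ t) ∂(selectionLaw G) := by
    refine lintegral_congr_ae ?_
    filter_upwards [ae_terminated_run (order := order) hG hdeg hmem] with ξ ⟨t, ht⟩
    rw [ofReal_list_sum_map _ (extendZero_nonneg hb), stackRep_eq hmem ht,
      (isTrajectory_run v order ξ).iSup_pathWeight hmem φ s ht]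
  have h2 : ∫⁻ η, ⨆ t, pathWeight v φ s
        ((explore (stackRead v) (stackUpd order) η)^[t] (init v)) ∂(selectionLaw G) =
      ∫⁻ η, ∑' t, φ ((explore walkRead (walkUpd v) η)^[t] (0, s)).2 ∂(selectionLaw G) := by
    refine lintegral_congr_ae ?_
    filter_upwards [ae_terminated_stack (order := order) hG hdeg hmem] with η ⟨t, ht⟩
    have htraj := isTrajectory_stack v order η
    rw [htraj.iSup_pathWeight hmem φ s ht]
    refine sum_loopIncludedPath_eq_tsum ((htraj.invariant t).hits_of_gray_eq_univ ht s) η 0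
      (fun x k w hk => ?_) φ (by simp [φ])
    rw [Pi.zero_apply, zero_add]
    exact stack_getElem?_eq_some v order η t x k w hk
  rw [h1, lintegral_iSup (fun t => measurable_comp_run v order t (pathWeight v φ s))
    (fun t t' htt' ξ => (isTrajectory_run v order ξ).monotone_pathWeight hmem φ s htt')]
  simp only [lintegral_run_eq_lintegral_stack hdeg v order (pathWeight v φ s)]
  rw [← lintegral_iSup
    (fun t => measurable_comp_iterate_explore (stackRead v) (stackUpd order) (init v) t
      (pathWeight v φ s))
    (fun t t' htt' η => (isTrajectory_stack v order η).monotone_pathWeight hmem φ s htt'), h2]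
  exact lintegral_tsum_walk hG hdeg b hb s

end Law

/-! ### Integrability and the two weights. -/

section Main

theorem normalizedPasses_eq_sum {V : Type*} [Fintype V] [DecidableEq V] (G : SimpleGraph V)
    [DecidableRel G.Adj] {v : V} (path : List V) (u : {x : V // x ≠ v}) :
    normalizedPasses G path u =
      (path.map (extendZero v (Pi.single u (1 / (G.degree u : ℝ))))).sum := by
  induction path with
  | nil => simp [normalizedPasses]
  | cons a l ih =>
    rw [List.map_cons, List.sum_cons, ← ih, normalizedPasses, normalizedPasses, List.count_cons]
    by_cases ha : a = u
    · subst ha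
      simp [add_div, add_comm]
    · have : extendZero v (Pi.single u (1 / (G.degree u : ℝ))) a = 0 := by
        unfold extendZero
        split_ifs with h
        · exact Pi.single_eq_of_ne (fun h' => ha (congrArg Subtype.val h')) _
        · rfl
      rw [this, zero_add, if_neg (by simpa using ha), add_zero]

theorem normalizedLength_eq_sum {V : Type*} [Fintype V] [DecidableEq V] (G : SimpleGraph V)
    [DecidableRel G.Adj] (v : V) (path : List V) :
    normalizedLength G v path =
      (path.map (extendZero v fun x => 1 / (G.degree x : ℝ))).sum := by
  induction path with
  | nil => simp [normalizedLength]
  | cons a l ih =>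
    rw [List.map_cons, List.sum_cons, ← ih]
    by_cases ha : a = v <;> simp [normalizedLength, extendZero, ha]

theorem integral_uniformOn_univ {V : Type*} [Fintype V] [MeasurableSpace V]
    [MeasurableSingletonClass V] (f : V → ℝ) :
    ∫ x, f x ∂(uniformOn (Set.univ : Set V)) = 1 / (Fintype.card V : ℝ) * ∑ x, f x := by
  rw [uniformOn, ProbabilityTheory.cond, integral_smul_measure, Measure.restrict_univ,
    integral_count]
  simp [Measure.count_univ]

variable {V : Type*} [Fintype V] [DecidableEq V] {G : SimpleGraph V} [DecidableRel G.Adj]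
  {v : V} {order : List V}

/-- Summing over starting nodes gives a column sum of the inverse, which symmetry turns into a row
sum. -/
theorem sum_dirichlet_single (u : {x : V // x ≠ v}) :
    ∑ s, dirichlet G v (Pi.single u 1) s = ((reducedLaplacian G v)⁻¹ *ᵥ 1) u := by
  rw [← Fintype.sum_subtype_add_sum_subtype (fun y => y ≠ v)]
  have h0 : ∑ y : {y : V // ¬ y ≠ v}, dirichlet G v (Pi.single u 1) y = 0 :=
    Finset.sum_eq_zero fun y _ => by simp [not_not.1 y.2, dirichlet]
  have hsymm : ((reducedLaplacian G v)⁻¹).IsSymm := by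
    rw [IsSymm, transpose_nonsing_inv, (reducedLaplacian_isSymm v).eq]
  rw [h0, add_zero, mulVec, dotProduct]
  refine Finset.sum_congr rfl fun y _ => ?_
  rw [dirichlet, extendZero_coe, mulVec_single_one, Pi.one_apply, mul_one, col_apply,
    hsymm.apply]

variable [MeasurableSpace V] [MeasurableSingletonClass V]

/-- Almost surely the stacks at time `t` are eventually the final ones, so the functional is an
almost everywhere limit of measurable functions. -/
theorem aemeasurable_stackRep {α : Type*} [MeasurableSpace α] {μ : Measure α} (hG : G.Connected)
    (hdeg : ∀ x, 0 < G.degree x) (hmem : ∀ x, x ∈ order ↔ x ≠ v) {p : α → ℕ × V → V}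
    (hp : Measure.QuasiMeasurePreserving p μ (selectionLaw G)) (F : α → (V → List V) → ℝ)
    (hF : ∀ t, Measurable fun a => F a (run v order (p a) t).stack) :
    AEMeasurable (fun a => F a (stackRep v order (p a))) μ := by
  refine aemeasurable_of_tendsto_metrizable_ae Filter.atTop (fun t => (hF t).aemeasurable) ?_
  filter_upwards [hp.ae (ae_terminated_run (order := order) hG hdeg hmem)] with a ⟨t, ht⟩
  refine tendsto_const_nhds.congr' ?_
  filter_upwards [Filter.eventually_ge_atTop t] with t' ht'
  rw [stackRep_eq hmem ht, (isTrajectory_run v order (p a)).eq_of_terminated hmem ht ht']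

theorem integrable_loopIncludedPath (hG : G.Connected) (hdeg : ∀ x, 0 < G.degree x)
    (hmem : ∀ x, x ∈ order ↔ x ≠ v) (b : {x : V // x ≠ v} → ℝ) (hb : ∀ x, 0 ≤ b x) (s : V) :
    Integrable (fun ξ => ((loopIncludedPath v (stackRep v order ξ) s).map (extendZero v b)).sum)
      (selectionLaw G) := by
  have hm := aemeasurable_stackRep hG hdeg hmem
    (Measure.QuasiMeasurePreserving.id (selectionLaw G))
    (fun _ S => ((loopIncludedPath v S s).map (extendZero v b)).sum)
    (fun t => measurable_comp_run v order t fun st =>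
      ((loopIncludedPath v st.stack s).map (extendZero v b)).sum)
  refine (lintegral_ofReal_ne_top_iff_integrable hm.aestronglyMeasurable
    (Filter.Eventually.of_forall fun ξ => ?_)).1 ?_
  · exact List.sum_nonneg (by simpa using fun x _ => extendZero_nonneg hb x)
  · simp only [id]
    rw [lintegral_loopIncludedPath hG hdeg hmem b hb s]
    exact ENNReal.ofReal_ne_top

theorem integral_loopIncludedPath (hG : G.Connected) (hdeg : ∀ x, 0 < G.degree x)
    (hmem : ∀ x, x ∈ order ↔ x ≠ v) (b : {x : V // x ≠ v} → ℝ) (hb : ∀ x, 0 ≤ b x) (s : V) :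
    ∫ ξ, ((loopIncludedPath v (stackRep v order ξ) s).map (extendZero v b)).sum
      ∂(selectionLaw G) = dirichlet G v (fun y => G.degree y * b y) s := by
  rw [integral_eq_lintegral_of_nonneg_ae (Filter.Eventually.of_forall fun ξ => ?_)
    (integrable_loopIncludedPath hG hdeg hmem b hb s).aestronglyMeasurable,
    lintegral_loopIncludedPath hG hdeg hmem b hb s, ENNReal.toReal_ofReal]
  · exact dirichlet_nonneg hG v _ (fun y => mul_nonneg (Nat.cast_nonneg _) (hb y)) s
  · exact List.sum_nonneg (by simpa using fun x _ => extendZero_nonneg hb x)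

theorem integrable_prod_loopIncludedPath (hG : G.Connected) (hdeg : ∀ x, 0 < G.degree x)
    (hmem : ∀ x, x ∈ order ↔ x ≠ v) (b : {x : V // x ≠ v} → ℝ) (hb : ∀ x, 0 ≤ b x) :
    Integrable (fun p : V × (ℕ × V → V) =>
        ((loopIncludedPath v (stackRep v order p.2) p.1).map (extendZero v b)).sum)
      ((uniformOn (Set.univ : Set V)).prod (selectionLaw G)) := by
  have := isProbabilityMeasure_selectionLaw hdeg
  have : Nonempty V := ⟨v⟩
  have : IsProbabilityMeasure (uniformOn (Set.univ : Set V)) :=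
    isProbabilityMeasure_uniformOn Set.finite_univ Set.univ_nonempty
  refine (integrable_prod_iff (aemeasurable_stackRep hG hdeg hmem
    Measure.quasiMeasurePreserving_snd
    (fun p S => ((loopIncludedPath v S p.1).map (extendZero v b)).sum)
    fun t => ?_).aestronglyMeasurable).2 ⟨?_, Integrable.of_finite⟩
  · exact measurable_from_prod_countable_right fun s => measurable_comp_run v order t fun st =>
      ((loopIncludedPath v st.stack s).map (extendZero v b)).sum
  · exact Filter.Eventually.of_forall fun s => integrable_loopIncludedPath hG hdeg hmem b hb s

end Main

end LoopErased

theorem mainTheorem10 {V : Type*} [Fintype V] [DecidableEq V]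
    [MeasurableSpace V] [MeasurableSingletonClass V]
    (G : SimpleGraph V) [DecidableRel G.Adj] (hG : G.Connected)
    (v : V) (order : List V) (horder : order.Nodup) (hmem : ∀ x, x ∈ order ↔ x ≠ v) :
    IsUnit (LoopErased.reducedLaplacian G v).det ∧
    (∀ᵐ ξ ∂(LoopErased.selectionLaw G),
      (∃ t, LoopErased.TerminatedAt v order ξ t) ∧
      ∀ s, (LoopErased.loopIncludedPath v (LoopErased.stackRep v order ξ) s).getLast? = some v) ∧
    ∀ u : {x : V // x ≠ v},
      (Integrable
          (fun p : V × (ℕ × V → V) => LoopErased.normalizedPasses G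
            (LoopErased.loopIncludedPath v (LoopErased.stackRep v order p.2) p.1) u.1)
          ((uniformOn (Set.univ : Set V)).prod (LoopErased.selectionLaw G)) ∧
        ∫ p : V × (ℕ × V → V), LoopErased.normalizedPasses G
            (LoopErased.loopIncludedPath v (LoopErased.stackRep v order p.2) p.1) u.1
          ∂((uniformOn (Set.univ : Set V)).prod (LoopErased.selectionLaw G)) =
          1 / (Fintype.card V : ℝ) *
            (Pi.single u 1 ⬝ᵥ ((LoopErased.reducedLaplacian G v)⁻¹ *ᵥ 1))) ∧
      (Integrable
          (fun ξ : ℕ × V → V => LoopErased.normalizedLength G v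
            (LoopErased.loopIncludedPath v (LoopErased.stackRep v order ξ) u.1))
          (LoopErased.selectionLaw G) ∧
        ∫ ξ : ℕ × V → V, LoopErased.normalizedLength G v
            (LoopErased.loopIncludedPath v (LoopErased.stackRep v order ξ) u.1)
          ∂(LoopErased.selectionLaw G) =
          Pi.single u 1 ⬝ᵥ ((LoopErased.reducedLaplacian G v)⁻¹ *ᵥ 1)) := by
  refine ⟨LoopErased.isUnit_det_reducedLaplacian hG v, ?_⟩
  -- For a single node the degree is zero and no selection law is available, but everything is gray
  -- at time `0` and there is no `u`.
  rcases subsingleton_or_nontrivial V with hV | hV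
  · refine ⟨Filter.Eventually.of_forall fun ξ => ?_, fun u => (u.2 (Subsingleton.elim _ _)).elim⟩
    have ht : LoopErased.TerminatedAt v order ξ 0 :=
      Finset.eq_univ_iff_forall.2 fun x => Finset.mem_singleton.2 (Subsingleton.elim _ _)
    refine ⟨⟨0, ht⟩, fun s => ?_⟩
    exact (LoopErased.Hits.here (Set.mem_singleton_iff.2
      (Subsingleton.elim _ _))).getLast?_loopIncludedPath
  have hdeg : ∀ x, 0 < G.degree x := fun x => hG.preconnected.degree_pos_of_nontrivial x
  refine ⟨?_, fun u => ⟨?_, ?_⟩⟩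
  · filter_upwards [LoopErased.ae_terminated_run (order := order) hG hdeg hmem] with ξ hξ
    refine ⟨hξ, fun s => ?_⟩
    obtain ⟨t, ht⟩ := hξ
    rw [LoopErased.stackRep_eq hmem ht]
    exact (((LoopErased.isTrajectory_run v order ξ).invariant t).hits_of_gray_eq_univ ht
      s).getLast?_loopIncludedPath
  · have hb : ∀ x, (0 : ℝ) ≤ (Pi.single u (1 / (G.degree u : ℝ)) : {x : V // x ≠ v} → ℝ) x :=
      (Pi.single_nonneg (i := u) (α := fun _ => ℝ)).2 (by positivity)
    -- The normalization by `d_u` cancels the degree, leaving the right-hand side `e_u`.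
    have hdb : (fun y : {x : V // x ≠ v} => (G.degree y : ℝ) *
        (Pi.single u (1 / (G.degree u : ℝ)) : {x : V // x ≠ v} → ℝ) y) = Pi.single u 1 := by
      funext y
      by_cases hy : y = u
      · subst hy
        simp [(hdeg y).ne']
      · simp [hy]
    have := LoopErased.isProbabilityMeasure_selectionLaw hdeg
    have hint := LoopErased.integrable_prod_loopIncludedPath hG hdeg hmem _ hb
    simp only [LoopErased.normalizedPasses_eq_sum]
    refine ⟨hint, ?_⟩
    rw [integral_prod _ hint]
    simp only [LoopErased.integral_loopIncludedPath hG hdeg hmem _ hb, hdb]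
    rw [LoopErased.integral_uniformOn_univ, LoopErased.sum_dirichlet_single,
      single_one_dotProduct]
  · have hb : ∀ x : {x : V // x ≠ v}, (0 : ℝ) ≤ 1 / (G.degree x : ℝ) := fun x => by positivity
    have hdb : (fun y : {x : V // x ≠ v} => (G.degree y : ℝ) * (1 / (G.degree y : ℝ))) = 1 := by
      funext y
      simp [(hdeg y).ne']
    simp only [LoopErased.normalizedLength_eq_sum]
    refine ⟨LoopErased.integrable_loopIncludedPath hG hdeg hmem _ hb u, ?_⟩
    rw [LoopErased.integral_loopIncludedPath hG hdeg hmem _ hb, hdb, LoopErased.dirichlet,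
      LoopErased.extendZero_coe, single_one_dotProduct]
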